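/- Let $X_1, X_2, \ldots$ be independent random variables, each uniformly distributed on $[0,1]$. For real $t \ge 0$ let $$K_t = \min\{\, n \in \mathbb{N} : X_1 + \cdots + X_n > t \,\} \in \mathbb{N} \cup \{\infty\}, \qquad \min\emptyset = \infty,$$ be the number of draws until the sum exceeds $t$, and let $M(t) = \mathbb{E}[K_t]$ be its expected value. Then $M(t)$ is finite for every $t \ge 0$, and $$M(t) = 2t + \tfrac{2}{3} + o(1) \qquad (t \to \infty,\ t \in \mathbb{R}).$$ -/

import Mathlib

open MeasureTheory ProbabilityTheory Filter Asymptotics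
open scoped ENNReal

/-- The number of terms of `x 0, x 1, …` that must be added until the sum exceeds `t`: the least `n`
with `x 0 + ⋯ + x (n - 1) > t`, and `∞` if there is no such `n`. -/
noncomputable def numDraws (x : ℕ → ℝ) (t : ℝ) : ℕ∞ :=
  sInf {N : ℕ∞ | ∃ n : ℕ, N = n ∧ t < ∑ i ∈ Finset.range n, x i}

/-- The expected number, in `[0, ∞]`, of draws `X 0, X 1, …` until their sum exceeds `t`. -/
noncomputable def expectedDraws {Ω : Type*} [MeasurableSpace Ω] (μ : Measure Ω)
    (X : ℕ → Ω → ℝ) (t : ℝ) : ℝ≥0∞ :=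
  ∫⁻ ω, ((numDraws (fun i => X i ω) t : ℕ∞) : ℝ≥0∞) ∂μ

/-! Draws are nonnegative, so `K_t` counts the `n` with `S_n ≤ t`, and `M(t)` is the sum of the
distribution functions `F n t` of `S_n`. Conditioning on the last draw makes `F (n + 1)` the
unit-window average of `F n`; summing, `M(t) = 1 + ∫ M` over `[t - 1, t]` for `t ≥ 0`, with `M =
exp` on `[0, 1]`. The error `f(t) = M(t) - (2t + 2/3)` then equals its own window average for `t ≥
1`. Its first moment about the window's left end is conserved, and `2/3` is the constant making it
vanish. Hence `f(t) = ∫ (t - s) f(s)`, a kernel of mass `1/2`, and `f` decays geometrically. -/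

/-! ### Fixed points of the unit moving average -/

/-- The first moment of a fixed point of the unit moving average over the window `[t - 1, t]` does
not depend on `t`. -/
theorem movingAverage_moment_eq {f : ℝ → ℝ} (hf : Continuous f)
    (havg : ∀ t, 1 ≤ t → f t = ∫ s in (t - 1)..t, f s) {t : ℝ} (ht : 1 ≤ t) :
    ∫ s in (t - 1)..t, (s - (t - 1)) * f s = ∫ s in (0 : ℝ)..1, s * f s := by
  have hsf : Continuous fun s : ℝ => s * f s := by fun_prop
  set G : ℝ → ℝ := fun t => ∫ s in (0 : ℝ)..t, f s with hG
  set H : ℝ → ℝ := fun t => ∫ s in (0 : ℝ)..t, s * f s with hH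
  have hGd : ∀ t, HasDerivAt G (f t) t := fun t => hf.integral_hasStrictDerivAt 0 t |>.hasDerivAt
  have hHd : ∀ t, HasDerivAt H (t * f t) t := fun t =>
    hsf.integral_hasStrictDerivAt 0 t |>.hasDerivAt
  have hGw : ∀ t, ∫ s in (t - 1)..t, f s = G t - G (t - 1) := fun t =>
    (intervalIntegral.integral_interval_sub_left (hf.intervalIntegrable _ _)
      (hf.intervalIntegrable _ _)).symm
  have hHw : ∀ t, ∫ s in (t - 1)..t, s * f s = H t - H (t - 1) := fun t =>
    (intervalIntegral.integral_interval_sub_left (hsf.intervalIntegrable _ _)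
      (hsf.intervalIntegrable _ _)).symm
  set J : ℝ → ℝ := fun t => H t - H (t - 1) - (t - 1) * (G t - G (t - 1)) with hJ
  have hJd : ∀ t, HasDerivAt J (t * f t - (t - 1) * f (t - 1) -
      (1 * (G t - G (t - 1)) + (t - 1) * (f t - f (t - 1)))) t := by
    intro t
    have h1 := (hHd (t - 1)).comp_sub_const t 1
    have h2 := (hGd (t - 1)).comp_sub_const t 1
    exact ((hHd t).sub h1).sub (((hasDerivAt_id t).sub_const 1).mul ((hGd t).sub h2))
  -- `J'` simplifies to `f x` minus its window integral, which is zero.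
  have hconst := constant_of_has_deriv_right_zero (f := J) (a := 1) (b := t)
    (fun x _ => (hJd x).continuousAt.continuousWithinAt)
    (fun x hx => by
      have h := (hJd x).hasDerivWithinAt (s := Set.Ici x)
      convert h using 1
      have := havg x hx.1
      rw [hGw] at this
      linear_combination -this)
    t ⟨ht, le_rfl⟩
  have h1 : ∫ s in (t - 1)..t, (s - (t - 1)) * f s = J t := by
    simp only [hJ, ← hGw, ← hHw]
    rw [← intervalIntegral.integral_const_mul, ← intervalIntegral.integral_sub]
    · simp only [sub_mul]
    · exact hsf.intervalIntegrable _ _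
    · exact (continuous_const.mul hf).intervalIntegrable _ _
  rw [h1, hconst]
  simp [hJ, hH]

/-- A fixed point of the unit moving average whose first moment vanishes is bounded by half its
supremum over the preceding unit window. -/
theorem abs_le_half_of_movingAverage {f : ℝ → ℝ} (hf : Continuous f)
    (havg : ∀ t, 1 ≤ t → f t = ∫ s in (t - 1)..t, f s)
    (hmom : ∫ s in (0 : ℝ)..1, s * f s = 0) {t C : ℝ} (ht : 1 ≤ t)
    (hC : ∀ s ∈ Set.Icc (t - 1) t, |f s| ≤ C) : |f t| ≤ C / 2 := by
  have key : f t = ∫ s in (t - 1)..t, (t - s) * f s := by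
    have h0 := movingAverage_moment_eq hf havg ht
    rw [hmom] at h0
    have h1 := havg t ht
    have h2 : ∫ s in (t - 1)..t, (t - s) * f s =
        (∫ s in (t - 1)..t, f s) - ∫ s in (t - 1)..t, (s - (t - 1)) * f s := by
      rw [← intervalIntegral.integral_sub (hf.intervalIntegrable _ _)
        (Continuous.intervalIntegrable (by fun_prop) _ _)]
      congr 1; ext s; ring
    rw [h2, h0, sub_zero, ← h1]
  have hint : ∫ s in (t - 1)..t, (t - s) * C = C / 2 := by
    rw [intervalIntegral.integral_mul_const, intervalIntegral.integral_sub (by simp) (by simp)]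
    simp only [intervalIntegral.integral_const, integral_id, smul_eq_mul]
    ring
  rw [key, ← hint, ← Real.norm_eq_abs]
  refine intervalIntegral.norm_integral_le_of_norm_le (by linarith) ?_
    (Continuous.intervalIntegrable (by fun_prop) _ _)
  filter_upwards with s hs
  rw [norm_mul, Real.norm_of_nonneg (by linarith [hs.2])]
  exact mul_le_mul_of_nonneg_left (hC s ⟨hs.1.le, hs.2⟩) (by linarith [hs.2])

theorem tendsto_zero_of_movingAverage {f : ℝ → ℝ} (hf : Continuous f)
    (havg : ∀ t, 1 ≤ t → f t = ∫ s in (t - 1)..t, f s)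
    (hmom : ∫ s in (0 : ℝ)..1, s * f s = 0) : Tendsto f atTop (nhds 0) := by
  have step : ∀ (n : ℕ) (B : ℝ), (∀ s ∈ Set.Icc (n : ℝ) (n + 1), |f s| ≤ B) →
      ∀ s ∈ Set.Icc ((n : ℝ) + 1) (n + 1 + 1), |f s| ≤ B / 2 := by
    intro n B hB
    have hn : (0 : ℝ) ≤ n := n.cast_nonneg
    -- The window before `s` overlaps the new interval, so both intervals are bounded together: a
    -- maximum attained in the later one is at most half itself, hence zero.
    obtain ⟨t₀, ht₀, hmax⟩ := (isCompact_Icc (a := (n : ℝ)) (b := n + 1 + 1)).exists_isMaxOn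
      ⟨n, by constructor <;> linarith⟩ (hf.abs.continuousOn)
    have hmax' : ∀ s ∈ Set.Icc (n : ℝ) (n + 1 + 1), |f s| ≤ |f t₀| := fun s hs => hmax hs
    have hle : |f t₀| ≤ B := by
      rcases le_total t₀ (n + 1) with h | h
      · exact hB _ ⟨ht₀.1, h⟩
      · have h1 := abs_le_half_of_movingAverage hf havg hmom (t := t₀) (by linarith)
          (fun s hs => hmax' s ⟨by linarith [hs.1], by linarith [hs.2, ht₀.2]⟩)
        have h2 := hB n ⟨le_rfl, by linarith⟩
        linarith [abs_nonneg (f n), abs_nonneg (f t₀)]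
    intro s hs
    exact abs_le_half_of_movingAverage hf havg hmom (by linarith [hs.1]) fun r hr =>
      (hmax' r ⟨by linarith [hs.1, hr.1], by linarith [hs.2, hr.2]⟩).trans hle
  obtain ⟨A, hA⟩ := (isCompact_Icc (a := (0 : ℝ)) (b := 1)).exists_bound_of_continuousOn
    hf.continuousOn
  have hbound : ∀ n : ℕ, ∀ s ∈ Set.Icc (n : ℝ) (n + 1), |f s| ≤ A * (1 / 2) ^ n := by
    intro n
    induction n with
    | zero => simpa using hA
    | succ n ih =>
      intro s hs
      have := step n _ ih s (by simpa using hs)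
      rw [pow_succ]; linarith
  have hlim : Tendsto (fun t : ℝ => A * (1 / 2 : ℝ) ^ ⌊t⌋₊) atTop (nhds 0) := by
    simpa using ((tendsto_pow_atTop_nhds_zero_of_lt_one (by norm_num : (0 : ℝ) ≤ 1 / 2)
      (by norm_num)).comp (tendsto_nat_floor_atTop (α := ℝ))).const_mul A
  refine squeeze_zero_norm' ?_ hlim
  filter_upwards [eventually_ge_atTop 0] with t ht
  exact hbound _ t ⟨Nat.floor_le ht, (Nat.lt_floor_add_one t).le⟩


/-! ### Irwin–Hall distribution functions and the renewal equation -/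

theorem irwinHall_nonneg {F : ℕ → ℝ → ℝ} (h0 : ∀ t, F 0 t = if 0 ≤ t then 1 else 0)
    (hsucc : ∀ n t, F (n + 1) t = ∫ s in (t - 1)..t, F n s) (n : ℕ) (t : ℝ) : 0 ≤ F n t := by
  induction n generalizing t with
  | zero => rw [h0]; split_ifs <;> norm_num
  | succ n ih =>
    rw [hsucc]
    exact intervalIntegral.integral_nonneg (by linarith) fun s _ => ih s

/-- `exp` is an eigenfunction of the window average with eigenvalue `1 - exp (-1) < 1`; this
geometric bound gives summability and domination. -/
theorem irwinHall_le {F : ℕ → ℝ → ℝ} (h0 : ∀ t, F 0 t = if 0 ≤ t then 1 else 0)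
    (hsucc : ∀ n t, F (n + 1) t = ∫ s in (t - 1)..t, F n s) (hmono : ∀ n, Monotone (F n))
    (n : ℕ) (t : ℝ) : F n t ≤ (1 - Real.exp (-1)) ^ n * Real.exp t := by
  induction n generalizing t with
  | zero =>
    rw [h0]
    split_ifs with h
    · simpa using h
    · positivity
  | succ n ih =>
    rw [hsucc]
    calc ∫ s in (t - 1)..t, F n s
        ≤ ∫ s in (t - 1)..t, (1 - Real.exp (-1)) ^ n * Real.exp s :=
          intervalIntegral.integral_mono_on (by linarith) (hmono n).intervalIntegrable
            (Continuous.intervalIntegrable (by fun_prop) _ _) fun s _ => ih s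
      _ = (1 - Real.exp (-1)) ^ (n + 1) * Real.exp t := by
          rw [intervalIntegral.integral_const_mul, integral_exp, sub_eq_add_neg t 1, Real.exp_add]
          ring

theorem irwinHall_of_neg {F : ℕ → ℝ → ℝ} (h0 : ∀ t, F 0 t = if 0 ≤ t then 1 else 0)
    (hsucc : ∀ n t, F (n + 1) t = ∫ s in (t - 1)..t, F n s) (n : ℕ) {t : ℝ} (ht : t < 0) :
    F n t = 0 := by
  induction n generalizing t with
  | zero => rw [h0, if_neg ht.not_ge]
  | succ n ih =>
    rw [hsucc, intervalIntegral.integral_congr (g := fun _ => 0), intervalIntegral.integral_zero]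
    intro s hs
    rw [Set.uIcc_of_le (by linarith)] at hs
    exact ih (hs.2.trans_lt ht)

theorem irwinHall_of_mem_Icc {F : ℕ → ℝ → ℝ} (h0 : ∀ t, F 0 t = if 0 ≤ t then 1 else 0)
    (hsucc : ∀ n t, F (n + 1) t = ∫ s in (t - 1)..t, F n s) (hmono : ∀ n, Monotone (F n))
    (n : ℕ) {t : ℝ} (ht : t ∈ Set.Icc (0 : ℝ) 1) : F n t = t ^ n / n.factorial := by
  induction n generalizing t with
  | zero => simp [h0, ht.1]
  | succ n ih =>
    rw [hsucc, ← intervalIntegral.integral_add_adjacent_intervals (b := 0)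
      (hmono n).intervalIntegrable (hmono n).intervalIntegrable]
    have h1 : ∫ s in (t - 1)..0, F n s = 0 := by
      -- The endpoint is dropped because `F 0 0 = 1`.
      rw [intervalIntegral.integral_of_le (by linarith [ht.2]), integral_Ioc_eq_integral_Ioo]
      exact setIntegral_eq_zero_of_forall_eq_zero fun s hs => irwinHall_of_neg h0 hsucc n hs.2
    have h2 : ∫ s in (0 : ℝ)..t, F n s = ∫ s in (0 : ℝ)..t, s ^ n / n.factorial := by
      refine intervalIntegral.integral_congr fun s hs => ?_
      rw [Set.uIcc_of_le ht.1] at hs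
      exact ih ⟨hs.1, hs.2.trans ht.2⟩
    rw [h1, h2, zero_add, intervalIntegral.integral_div, integral_pow, Nat.factorial_succ]
    push_cast
    have := Nat.factorial_ne_zero n
    field_simp
    simp

theorem irwinHall_summable {F : ℕ → ℝ → ℝ} (h0 : ∀ t, F 0 t = if 0 ≤ t then 1 else 0)
    (hsucc : ∀ n t, F (n + 1) t = ∫ s in (t - 1)..t, F n s) (hmono : ∀ n, Monotone (F n))
    (t : ℝ) : Summable fun n => F n t := by
  have h1 : Real.exp (-1) < 1 := by simp
  exact Summable.of_nonneg_of_le (irwinHall_nonneg h0 hsucc · t) (irwinHall_le h0 hsucc hmono · t)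
    ((summable_geometric_of_lt_one (by linarith) (by linarith [Real.exp_pos (-1)])).mul_right _)

/-- The renewal equation. -/
theorem irwinHall_tsum_eq {F : ℕ → ℝ → ℝ} (h0 : ∀ t, F 0 t = if 0 ≤ t then 1 else 0)
    (hsucc : ∀ n t, F (n + 1) t = ∫ s in (t - 1)..t, F n s) (hmono : ∀ n, Monotone (F n))
    {t : ℝ} (ht : 0 ≤ t) : ∑' n, F n t = 1 + ∫ s in (t - 1)..t, ∑' n, F n s := by
  have h1 : Real.exp (-1) < 1 := by simp
  have hq := summable_geometric_of_lt_one (r := 1 - Real.exp (-1)) (by linarith)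
    (by linarith [Real.exp_pos (-1)])
  have hs : HasSum (fun n => ∫ s in (t - 1)..t, F n s) (∫ s in (t - 1)..t, ∑' n, F n s) := by
    refine intervalIntegral.hasSum_integral_of_dominated_convergence
      (fun n s => (1 - Real.exp (-1)) ^ n * Real.exp s)
      (fun n => (hmono n).measurable.aestronglyMeasurable) (fun n => .of_forall fun s _ => ?_)
      (.of_forall fun s _ => hq.mul_right _) ?_
      (.of_forall fun s _ => (irwinHall_summable h0 hsucc hmono s).hasSum)
    · rw [Real.norm_of_nonneg (irwinHall_nonneg h0 hsucc n s)]
      exact irwinHall_le h0 hsucc hmono n s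
    · simp only [tsum_mul_right]
      exact Continuous.intervalIntegrable (by fun_prop) _ _
  rw [(irwinHall_summable h0 hsucc hmono t).tsum_eq_zero_add, h0, if_pos ht, ← hs.tsum_eq]
  simp only [hsucc]

theorem irwinHall_tsum_of_mem_Icc {F : ℕ → ℝ → ℝ} (h0 : ∀ t, F 0 t = if 0 ≤ t then 1 else 0)
    (hsucc : ∀ n t, F (n + 1) t = ∫ s in (t - 1)..t, F n s) (hmono : ∀ n, Monotone (F n))
    {t : ℝ} (ht : t ∈ Set.Icc (0 : ℝ) 1) : ∑' n, F n t = Real.exp t := by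
  rw [Real.exp_eq_exp_ℝ, NormedSpace.exp_eq_tsum_div]
  exact tsum_congr fun n => irwinHall_of_mem_Icc h0 hsucc hmono n ht

theorem irwinHall_tsum_asymptotic {F : ℕ → ℝ → ℝ} (h0 : ∀ t, F 0 t = if 0 ≤ t then 1 else 0)
    (hsucc : ∀ n t, F (n + 1) t = ∫ s in (t - 1)..t, F n s) (hmono : ∀ n, Monotone (F n)) :
    Tendsto (fun t => ∑' n, F n t - (2 * t + 2 / 3)) atTop (nhds 0) := by
  set M : ℝ → ℝ := fun t => ∑' n, F n t with hM
  have hMmono : Monotone M := fun s t hst =>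
    (irwinHall_summable h0 hsucc hmono s).tsum_le_tsum (fun n => hmono n hst)
      (irwinHall_summable h0 hsucc hmono t)
  have hMint : ∀ a b, IntervalIntegrable M volume a b := fun a b => hMmono.intervalIntegrable
  have hMeq : ∀ t, 0 ≤ t → M t = 1 + ∫ s in (t - 1)..t, M s := fun t ht =>
    irwinHall_tsum_eq h0 hsucc hmono ht
  -- Defined through the integral to be continuous on all of `ℝ`; `M` itself jumps at `0`.
  set f : ℝ → ℝ := fun t => 1 + (∫ s in (t - 1)..t, M s) - (2 * t + 2 / 3) with hf
  have hfM : ∀ t, 0 ≤ t → f t = M t - (2 * t + 2 / 3) := fun t ht => by rw [hf, hMeq t ht]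
  have hfc : Continuous f := by
    have hc := intervalIntegral.continuous_primitive hMint 0
    have : f = fun t => 1 + ((∫ s in (0 : ℝ)..t, M s) - ∫ s in (0 : ℝ)..(t - 1), M s) -
        (2 * t + 2 / 3) := by
      ext t
      rw [intervalIntegral.integral_interval_sub_left (hMint _ _) (hMint _ _)]
    rw [this]
    have := hc.comp (continuous_sub_right (1 : ℝ))
    exact (continuous_const.add (hc.sub this)).sub (by fun_prop)
  have havg : ∀ t, 1 ≤ t → f t = ∫ s in (t - 1)..t, f s := by
    intro t ht
    have h1 : ∫ s in (t - 1)..t, f s = ∫ s in (t - 1)..t, (M s - (2 * s + 2 / 3)) := by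
      refine intervalIntegral.integral_congr fun s hs => hfM s ?_
      rw [Set.uIcc_of_le (by linarith)] at hs
      linarith [hs.1]
    rw [h1, intervalIntegral.integral_sub (hMint _ _)
      (Continuous.intervalIntegrable (by fun_prop) _ _), intervalIntegral.integral_add
      (Continuous.intervalIntegrable (by fun_prop) _ _) (by simp),
      intervalIntegral.integral_const_mul, integral_id, intervalIntegral.integral_const]
    simp only [hf, smul_eq_mul]
    ring
  have hmom : ∫ s in (0 : ℝ)..1, s * f s = 0 := by
    -- This antiderivative equals `-1` at both ends.
    have hd : ∀ s ∈ Set.uIcc (0 : ℝ) 1, HasDerivAt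
        (fun s => (s - 1) * Real.exp s - 2 / 3 * s ^ 3 - 1 / 3 * s ^ 2)
        (s * (Real.exp s - (2 * s + 2 / 3))) s := by
      intro s _
      have h := (((((hasDerivAt_id s).sub_const 1).mul (Real.hasDerivAt_exp s)).sub
        ((hasDerivAt_pow 3 s).const_mul (2 / 3))).sub ((hasDerivAt_pow 2 s).const_mul (1 / 3)))
      refine h.congr_deriv ?_
      simp only [id]
      push_cast
      ring
    have h1 : ∫ s in (0 : ℝ)..1, s * f s =
        ∫ s in (0 : ℝ)..1, s * (Real.exp s - (2 * s + 2 / 3)) := by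
      refine intervalIntegral.integral_congr fun s hs => ?_
      rw [Set.uIcc_of_le zero_le_one] at hs
      simp only [hfM s hs.1, hM, irwinHall_tsum_of_mem_Icc h0 hsucc hmono hs]
    rw [h1, intervalIntegral.integral_eq_sub_of_hasDerivAt hd
      (Continuous.intervalIntegrable (by fun_prop) _ _)]
    norm_num
  refine (tendsto_zero_of_movingAverage hfc havg hmom).congr' ?_
  filter_upwards [eventually_ge_atTop 0] with t ht using hfM t ht

/-! ### From the number of draws to distribution functions -/

/-- Partial sums increase, so the indices counted form the initial segment below the first crossing,
or all of `ℕ` if there is none. -/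
theorem toENNReal_numDraws_eq_tsum {x : ℕ → ℝ} (hx : ∀ i, 0 ≤ x i) (t : ℝ) :
    ((numDraws x t : ℕ∞) : ℝ≥0∞) =
      ∑' n : ℕ, if ∑ i ∈ Finset.range n, x i ≤ t then (1 : ℝ≥0∞) else 0 := by
  have hmono : Monotone fun n => ∑ i ∈ Finset.range n, x i := fun m n hmn =>
    Finset.sum_le_sum_of_subset_of_nonneg (Finset.range_mono hmn) fun i _ _ => hx i
  by_cases h : ∃ n : ℕ, t < ∑ i ∈ Finset.range n, x i
  · classical
    have hN : numDraws x t = (Nat.find h : ℕ∞) := by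
      refine le_antisymm (sInf_le ⟨_, rfl, Nat.find_spec h⟩) (le_sInf ?_)
      rintro _ ⟨n, rfl, hn⟩
      exact_mod_cast Nat.find_min' h hn
    have hiff : ∀ n, ∑ i ∈ Finset.range n, x i ≤ t ↔ n ∈ Finset.range (Nat.find h) := by
      intro n
      rw [Finset.mem_range, Nat.lt_find_iff]
      exact ⟨fun hn m hm => not_lt.2 ((hmono hm).trans hn), fun hn => not_lt.1 (hn n le_rfl)⟩
    rw [hN, tsum_eq_sum (s := Finset.range (Nat.find h))
      fun n hn => if_neg (mt (hiff n).1 hn), Finset.sum_congr rfl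
      fun n hn => if_pos ((hiff n).2 hn)]
    simp
  · push Not at h
    have hN : numDraws x t = ⊤ := by
      refine sInf_eq_top.2 ?_
      rintro _ ⟨n, rfl, hn⟩
      exact absurd (h n) hn.not_ge
    simp [hN, h]

section Probability

variable {Ω : Type*} [MeasurableSpace Ω] {μ : Measure Ω}

theorem map_eq_volume_restrict_of_isUniform {Y : Ω → ℝ}
    (hY : pdf.IsUniform Y (Set.Icc (0 : ℝ) 1) μ volume) :
    μ.map Y = volume.restrict (Set.Icc 0 1) := by
  rw [hY, ProbabilityTheory.cond]
  simp

theorem aemeasurable_of_isUniform {Y : Ω → ℝ}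
    (hY : pdf.IsUniform Y (Set.Icc (0 : ℝ) 1) μ volume) : AEMeasurable Y μ :=
  pdf.IsUniform.aemeasurable (by simp) (by simp) hY

theorem ae_nonneg_of_isUniform {Y : Ω → ℝ}
    (hY : pdf.IsUniform Y (Set.Icc (0 : ℝ) 1) μ volume) : ∀ᵐ ω ∂μ, 0 ≤ Y ω := by
  refine ae_of_ae_map (p := fun y => 0 ≤ y) (aemeasurable_of_isUniform hY) ?_
  rw [map_eq_volume_restrict_of_isUniform hY]
  exact ae_restrict_of_forall_mem measurableSet_Icc fun y hy => hy.1

theorem monotone_measure_le [IsProbabilityMeasure μ] (S : Ω → ℝ) :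
    Monotone fun t => μ {ω | S ω ≤ t} :=
  fun _ _ hst => measure_mono fun _ hω => le_trans hω hst

/-- Fubini over the value `y` of `Y`, then the substitution `s = t - y`. -/
theorem measureReal_add_le_eq_integral [IsProbabilityMeasure μ] {S Y : Ω → ℝ}
    (hS : AEMeasurable S μ) (hY : pdf.IsUniform Y (Set.Icc (0 : ℝ) 1) μ volume)
    (hSY : IndepFun S Y μ) (t : ℝ) :
    μ.real {ω | S ω + Y ω ≤ t} = ∫ s in (t - 1)..t, μ.real {ω | S ω ≤ s} := by
  have hYm := aemeasurable_of_isUniform hY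
  have hmeas : MeasurableSet {p : ℝ × ℝ | p.1 + p.2 ≤ t} :=
    measurableSet_le (by fun_prop) measurable_const
  have h1 : μ {ω | S ω + Y ω ≤ t} = ∫⁻ y in Set.Icc 0 1, μ {ω | S ω ≤ t - y} := by
    calc μ {ω | S ω + Y ω ≤ t} = μ.map (fun ω => (S ω, Y ω)) {p | p.1 + p.2 ≤ t} :=
          (Measure.map_apply_of_aemeasurable (hS.prodMk hYm) hmeas).symm
      _ = ∫⁻ y in Set.Icc 0 1, μ.map S ((fun x => (x, y)) ⁻¹' {p | p.1 + p.2 ≤ t}) := by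
          rw [(indepFun_iff_map_prod_eq_prod_map_map hS hYm).1 hSY,
            map_eq_volume_restrict_of_isUniform hY, Measure.prod_apply_symm hmeas]
      _ = _ := by
          refine lintegral_congr fun y => ?_
          rw [Measure.map_apply_of_aemeasurable hS (measurable_prodMk_right hmeas)]
          simp [le_sub_iff_add_le]
  have h2 := intervalIntegral.integral_comp_sub_left (a := 0) (b := 1)
    (fun s => μ.real {ω | S ω ≤ s}) t
  rw [sub_zero] at h2
  rw [← h2, intervalIntegral.integral_of_le zero_le_one, ← integral_Icc_eq_integral_Ioc,
    measureReal_def, h1]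
  refine (integral_toReal ?_ (.of_forall fun y => measure_lt_top _ _)).symm
  exact ((monotone_measure_le S).measurable.comp (measurable_const.sub measurable_id)).aemeasurable

theorem expectedDraws_eq_tsum [IsProbabilityMeasure μ] {X : ℕ → Ω → ℝ}
    (hX_unif : ∀ i, pdf.IsUniform (X i) (Set.Icc (0 : ℝ) 1) μ volume) (t : ℝ) :
    expectedDraws μ X t = ∑' n : ℕ, μ {ω | ∑ i ∈ Finset.range n, X i ω ≤ t} := by
  have hnull : ∀ n, NullMeasurableSet {ω | ∑ i ∈ Finset.range n, X i ω ≤ t} μ := fun n =>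
    nullMeasurableSet_le (Finset.aemeasurable_fun_sum _
      fun i _ => aemeasurable_of_isUniform (hX_unif i)) aemeasurable_const
  have hae : ∀ᵐ ω ∂μ, ∀ i, 0 ≤ X i ω := ae_all_iff.2 fun i => ae_nonneg_of_isUniform (hX_unif i)
  calc expectedDraws μ X t
      = ∫⁻ ω, ∑' n : ℕ, {ω | ∑ i ∈ Finset.range n, X i ω ≤ t}.indicator (fun _ => 1) ω ∂μ := by
        refine lintegral_congr_ae ?_
        filter_upwards [hae] with ω hω
        rw [toENNReal_numDraws_eq_tsum hω]
        simp [Set.indicator_apply]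
    _ = _ := by
        rw [lintegral_tsum fun n => (aemeasurable_const (b := (1 : ℝ≥0∞))).indicator₀ (hnull n)]
        exact tsum_congr fun n => lintegral_indicator_one₀ (hnull n)

end Probability

theorem mainTheorem3 {Ω : Type*} [MeasurableSpace Ω] (μ : Measure Ω) [IsProbabilityMeasure μ]
    (X : ℕ → Ω → ℝ) (hX_indep : iIndepFun X μ)
    (hX_unif : ∀ i, pdf.IsUniform (X i) (Set.Icc (0 : ℝ) 1) μ volume) :
    (∀ t : ℝ, 0 ≤ t → expectedDraws μ X t < ∞) ∧
      (fun t : ℝ => (expectedDraws μ X t).toReal - (2 * t + 2 / 3)) =o[atTop]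
        (fun _ => (1 : ℝ)) := by
  have hmeas : ∀ i, AEMeasurable (X i) μ := fun i => aemeasurable_of_isUniform (hX_unif i)
  set F : ℕ → ℝ → ℝ := fun n t => μ.real {ω | ∑ i ∈ Finset.range n, X i ω ≤ t} with hF
  have h0 : ∀ t, F 0 t = if 0 ≤ t then 1 else 0 := by
    intro t
    by_cases ht : 0 ≤ t <;> simp [hF, ht]
  have hsucc : ∀ n t, F (n + 1) t = ∫ s in (t - 1)..t, F n s := by
    intro n t
    have hind : IndepFun (fun ω => ∑ i ∈ Finset.range n, X i ω) (X n) μ := by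
      have := hX_indep.indepFun_finsetSum_of_notMem₀ hmeas (Finset.notMem_range_self (n := n))
      simpa only [← Finset.sum_apply] using this
    have := measureReal_add_le_eq_integral
      (Finset.aemeasurable_fun_sum _ fun i _ => hmeas i) (hX_unif n) hind t
    simpa only [hF, Finset.sum_range_succ] using this
  have hmono : ∀ n, Monotone (F n) := fun n s t hst =>
    ENNReal.toReal_mono (measure_ne_top _ _) (monotone_measure_le _ hst)
  have hM : ∀ t, expectedDraws μ X t = ENNReal.ofReal (∑' n, F n t) := by
    intro t
    rw [expectedDraws_eq_tsum hX_unif, ENNReal.ofReal_tsum_of_nonneg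
      (fun n => measureReal_nonneg) (irwinHall_summable h0 hsucc hmono t)]
    exact tsum_congr fun n => (ofReal_measureReal).symm
  refine ⟨fun t _ => hM t ▸ ENNReal.ofReal_lt_top, (isLittleO_one_iff ℝ).2 ?_⟩
  refine (irwinHall_tsum_asymptotic h0 hsucc hmono).congr fun t => ?_
  rw [hM, ENNReal.toReal_ofReal (tsum_nonneg fun n => measureReal_nonneg)]
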